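/- Let $Y$ be a compact topological $n$-manifold (possibly with boundary) and let $X \subseteq Y$ be a compact locally flat submanifold of dimension $d \le n$, without boundary: every $x \in X$ has an open neighbourhood $V$ in $Y$ with a homeomorphism $\varphi : V \to \mathbb{R}^n$ such that $\varphi(V \cap X) = \mathbb{R}^d \times 0$. An isotopy of $Y$ is a family $(h_t)_{t \in [0,1]}$ of homeomorphisms $Y \to Y$ with $h_0 = \mathrm{id}$ such that $h_t(y)$ and $h_t^{-1}(y)$ are continuous in $(t,y)$; its support is the closure of $\{y \in Y : h_t(y) \ne y \text{ for some } t\}$. For $E, F \subseteq Y$, say that $E$ is $I$-compressible to $X$ in $F$ if for every neighbourhood $D$ of $X$ there is an isotopy $(h_t)$ of $Y$ with support contained in $F$ such that $h_t$ is the identity on some neighbourhood of $X$ independent of $t$, and $h_1(E) \subseteq D$. Then the axiom $I\text{-}\mathrm{Comp}(Y,X)$ holds: there are neighbourhoods $E \subseteq F$ of $X$ in $Y$ such that $E$ is $I$-compressible to $X$ in $F$. Moreover, such pairs exist with arbitrarily small $F$: every neighbourhood $F$ of $X$ contains a neighbourhood $E$ of $X$ that is $I$-compressible to $X$ in $F$.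 -/

import Mathlib

open Set Topology

/-- The closed half-space `{x ∈ ℝⁿ : 0 ≤ x₀}`; for `n = 0` it is the one-point space `ℝ⁰`. -/
def ClosedHalfSpace (n : ℕ) : Type :=
  {x : EuclideanSpace ℝ (Fin n) // ∀ i : Fin n, (i : ℕ) = 0 → 0 ≤ x i}

instance (n : ℕ) : TopologicalSpace (ClosedHalfSpace n) :=
  inferInstanceAs (TopologicalSpace
    {x : EuclideanSpace ℝ (Fin n) // ∀ i : Fin n, (i : ℕ) = 0 → 0 ≤ x i})

/-- `Y` is a topological `n`-manifold, possibly with boundary: it is Hausdorff, second countable,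
and every point has an open neighbourhood homeomorphic to an open subset of the closed
half-space of dimension `n`. -/
structure IsTopologicalManifold (n : ℕ) (Y : Type*) [TopologicalSpace Y] : Prop where
  t2 : T2Space Y
  secondCountable : SecondCountableTopology Y
  exists_chart : ∀ y : Y, ∃ φ : OpenPartialHomeomorph Y (ClosedHalfSpace n), y ∈ φ.source

/-- The subset `ℝᵈ × 0` of `ℝⁿ`: all coordinates of index at least `d` vanish. -/
def flatSubspace (n d : ℕ) : Set (EuclideanSpace ℝ (Fin n)) :=
  {x | ∀ i : Fin n, d ≤ (i : ℕ) → x i = 0}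

/-- `X` is a locally flat `d`-dimensional submanifold (without boundary) of the `n`-manifold `Y`:
every `x ∈ X` has an open neighbourhood `V` in `Y` (the source of `φ`) with a homeomorphism
`φ : V → ℝⁿ` onto `ℝⁿ` such that `φ (V ∩ X) = ℝᵈ × 0`. -/
def IsLocallyFlat {Y : Type*} [TopologicalSpace Y] (n d : ℕ) (X : Set Y) : Prop :=
  ∀ x ∈ X, ∃ φ : OpenPartialHomeomorph Y (EuclideanSpace ℝ (Fin n)),
    x ∈ φ.source ∧ φ.target = univ ∧ φ '' (φ.source ∩ X) = flatSubspace n d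

/-- An (ambient) isotopy of `Y`: a family `h_t`, `t ∈ [0,1]`, of homeomorphisms of `Y` onto
itself with `h_0 = id`, such that `h_t(y)` and `h_t⁻¹(y)` are jointly continuous in `(t, y)`. -/
structure AmbientIsotopy (Y : Type*) [TopologicalSpace Y] where
  homeo : unitInterval → (Y ≃ₜ Y)
  continuous_homeo : Continuous fun p : unitInterval × Y => homeo p.1 p.2
  continuous_symm : Continuous fun p : unitInterval × Y => (homeo p.1).symm p.2
  homeo_zero : homeo 0 = Homeomorph.refl Y

/-- The support of an isotopy: the closure of the set of all points that it moves. -/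
def AmbientIsotopy.support {Y : Type*} [TopologicalSpace Y] (h : AmbientIsotopy Y) : Set Y :=
  closure {y | ∃ t : unitInterval, h.homeo t y ≠ y}

/-- `E` is `I`-compressible to `X` in `F`: for every neighbourhood `D` of `X` there is an isotopy
of `Y` which fixes every point of some neighbourhood `N` of `X` at all times, is supported in
`F`, and at time `1` carries `E` into `D`. -/
def ICompressible {Y : Type*} [TopologicalSpace Y] (X E F : Set Y) : Prop :=
  ∀ D ∈ 𝓝ˢ X, ∃ h : AmbientIsotopy Y,
    (∃ N ∈ 𝓝ˢ X, ∀ t : unitInterval, ∀ y ∈ N, h.homeo t y = y) ∧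
    h.support ⊆ F ∧
    h.homeo 1 '' E ⊆ D

/-- The axiom `I-Comp(Y, X)`: there are neighbourhoods `E ⊆ F` of `X` in `Y` such that `E` is
`I`-compressible to `X` in `F`. -/
def IComp (Y : Type*) [TopologicalSpace Y] (X : Set Y) : Prop :=
  ∃ E ∈ 𝓝ˢ X, ∃ F ∈ 𝓝ˢ X, E ⊆ F ∧ ICompressible X E F

/-! In a flat chart, `X` is a linear subspace. A tube over a ball of it can be pushed into an
arbitrarily thin tube by shrinking the fibres of the orthogonal projection, while a still thinner
tube stays fixed (`exists_tube_squeeze`). This isotopy has compact support, so it extends by the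
identity to `Y`. Hence `X` is compressible near each of its points, and compactness leaves finitely
many pieces to glue.

When isotopies are composed, the first may carry points out of the region that the second one
compresses. The induction therefore runs on the stronger property `FinelyCompressible`: time-one
displacements are below any given `ε`, and the width `δ` of the compressed neighbourhood depends on
`ε` but not on the target `D`. Locally this holds because displacement is bounded by the height of
the tube being squeezed, however thin the tube it is squeezed into. `FinelyCompressible.union` does
the gluing. -/

/-! ### Squeezing a tube around a linear subspace -/

/-- The factor `c` is read off from a piecewise linear increasing function `s * c s`: the identity
up to `η`, a gentle slope, then slope 2 until it meets the diagonal again at `r`. -/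
theorem exists_squeeze_profile {η r : ℝ} (hη : 0 < η) (hr : 2 * η < r) :
    ∃ c : ℝ → ℝ, Continuous c ∧ (∀ s, 0 < c s) ∧ (∀ s, c s ≤ 1) ∧ (∀ s ≤ η, c s = 1) ∧
      (∀ s, r ≤ s → c s = 1) ∧ (∀ s, 0 ≤ s → s ≤ r / 2 → s * c s ≤ 2 * η) ∧
      StrictMonoOn (fun s => s * c s) (Ici 0) := by
  have hr0 : 0 < r := by linarith
  -- With slope `η / r`, the gentle segment starting at `(η, η)` gains at most `η` up to `s = r`,
  -- hence stays below `2 * η`.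
  set θ : ℝ := η / r with hθ
  have hθ0 : 0 < θ := div_pos hη hr0
  have hθr : θ * r = η := div_mul_cancel₀ _ hr0.ne'
  have hθ1 : θ < 1 := by rw [hθ, div_lt_one hr0]; linarith
  have hm : ∀ s, 0 < max s η := fun s => lt_max_of_lt_right hη
  -- This is `g s / s`, with `s` replaced by `max s η` in denominators to avoid the singularity at
  -- `0`; the minimum with `1` is attained at `1` for `s ≤ η`.
  set c : ℝ → ℝ := fun s =>
    min 1 (max ((1 - θ) * η / max s η + θ) (2 - r / max s η)) with hc
  set g : ℝ → ℝ := fun s => min s (max ((1 - θ) * η + θ * s) (2 * s - r)) with hg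
  have hgmono : StrictMono g := by
    intro a b hab
    simp only [hg]
    have := mul_lt_mul_of_pos_left hab hθ0
    refine min_lt_min hab (max_lt_max ?_ ?_) <;> linarith
  have hc1 : ∀ s ≤ η, c s = 1 := by
    intro s hs
    simp only [hc, max_eq_right hs]
    refine min_eq_left (le_max_of_le_left ?_)
    rw [mul_div_cancel_right₀ _ hη.ne']
    linarith
  have hcg : ∀ s, s * c s = g s := by
    intro s
    rcases le_total s η with hs | hs
    · rw [hc1 s hs, mul_one]
      refine (min_eq_left (le_max_of_le_left ?_)).symm
      nlinarith
    · have hs0 : 0 < s := hη.trans_le hs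
      simp only [hc, hg, max_eq_left hs]
      rw [mul_min_of_nonneg _ _ hs0.le, mul_max_of_nonneg _ _ hs0.le]
      congr 2
      · ring
      · field_simp
      · field_simp
  refine ⟨c, ?_, ?_, fun s => min_le_left _ _, hc1, ?_, ?_, ?_⟩
  · have h1 : Continuous fun s : ℝ => max s η := by fun_prop
    have h2 : ∀ s : ℝ, max s η ≠ 0 := fun s => (hm s).ne'
    exact continuous_const.min (((continuous_const.div h1 h2).add continuous_const).max
      (continuous_const.sub (continuous_const.div h1 h2)))
  · intro s
    refine lt_min one_pos (lt_max_of_lt_left ?_)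
    have : 0 ≤ (1 - θ) * η / max s η := div_nonneg (by nlinarith) (hm s).le
    linarith
  · intro s hs
    have hs0 : 0 < s := hr0.trans_le hs
    have := hcg s
    have h2 : g s = s := min_eq_left (le_max_of_le_right (by linarith))
    rw [h2] at this
    exact mul_left_cancel₀ hs0.ne' (this.trans (mul_one s).symm)
  · intro s hs0 hs
    rw [hcg]
    refine (min_le_right _ _).trans (max_le ?_ (by linarith))
    nlinarith
  · intro a _ b _ hab
    simpa only [hcg] using hgmono hab

/-- A map stretching each fibre of a projection radially is bijective. -/
theorem bijective_fibrewise_stretch {E : Type*} [NormedAddCommGroup E] [NormedSpace ℝ E]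
    (P : E →L[ℝ] E) (hP : ∀ z, P (P z) = P z) (c : E → ℝ → ℝ)
    (hpos : ∀ u s, 0 < c u s) (hc : ∀ u, Continuous (c u))
    (hmono : ∀ u, StrictMonoOn (fun s => s * c u s) (Ici 0))
    (hid : ∀ u, ∃ R, ∀ s, R ≤ s → c u s = 1) :
    Function.Bijective fun z => P z + c (P z) ‖z - P z‖ • (z - P z) := by
  have hPs : ∀ (a : ℝ) z, P (a • (z - P z)) = 0 := by
    intro a z; simp [hP]
  constructor
  · intro z w h
    have hu : P z = P w := by
      have := congrArg P h
      simpa only [map_add, hP, hPs, add_zero] using this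
    simp only [← hu, add_right_inj] at h
    have hn := congrArg norm h
    rw [norm_smul, norm_smul, Real.norm_of_nonneg (hpos _ _).le,
      Real.norm_of_nonneg (hpos _ _).le, mul_comm, mul_comm (c _ _)] at hn
    have hs := (hmono (P z)).injOn (norm_nonneg _) (norm_nonneg _) hn
    rw [hs] at h
    have := smul_right_injective E (hpos (P z) ‖w - P z‖).ne' h
    exact sub_left_injective this
  · intro w
    set u := P w with hu
    rcases eq_or_ne (w - u) 0 with hw | hw
    · exact ⟨w, by simp only [← hu, hw, smul_zero, add_zero]; exact (sub_eq_zero.1 hw).symm⟩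
    have hn : 0 < ‖w - u‖ := norm_pos_iff.2 hw
    obtain ⟨R, hR⟩ := hid u
    set b := max R ‖w - u‖
    have hb0 : 0 ≤ b := hn.le.trans (le_max_right _ _)
    -- On each ray of the fibre over `u` the map is `s ↦ s * c u s`, which starts at `0` and is the
    -- identity past `R`, so the intermediate value theorem gives a preimage.
    obtain ⟨s, hs, hsw⟩ : ‖w - u‖ ∈ (fun s => s * c u s) '' Icc 0 b := by
      have hcont : Continuous fun s => s * c u s := continuous_id.mul (hc u)
      refine intermediate_value_Icc hb0 hcont.continuousOn ⟨?_, ?_⟩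
      · simp
      · rw [hR b (le_max_left _ _), mul_one]
        exact le_max_right _ _
    have hkey : P (u + (s / ‖w - u‖) • (w - u)) = u := by
      rw [map_add, hPs, hu, hP, add_zero]
    refine ⟨u + (s / ‖w - u‖) • (w - u), ?_⟩
    simp only [hkey, add_sub_cancel_left]
    rw [norm_smul, Real.norm_of_nonneg (div_nonneg hs.1 hn.le), div_mul_cancel₀ _ hn.ne', smul_smul]
    have : c u s * (s / ‖w - u‖) = 1 := by
      beta_reduce at hsw
      rw [← mul_div_assoc, mul_comm, hsw, div_self hn.ne']
    rw [this, one_smul, add_sub_cancel]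

/-- An isotopy of a normed space which squeezes a bounded part of a tube around the range of a
projection `P` into a thinner tube, along the fibres of `P`. -/
theorem exists_tube_squeeze {E : Type*} [NormedAddCommGroup E] [NormedSpace ℝ E]
    (P : E →L[ℝ] E) (hP : ∀ z, P (P z) = P z) (p : E) {η r : ℝ} (hη : 0 < η) (hr : 2 * η < r) :
    ∃ G : unitInterval → E → E, Continuous (fun q : unitInterval × E => G q.1 q.2) ∧
      (∀ t, Function.Bijective (G t)) ∧ (∀ z, G 0 z = z) ∧ (∀ t z, P (G t z) = P z) ∧
      (∀ t z, ‖G t z - z‖ ≤ ‖z - P z‖) ∧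
      (∀ t z, ‖G t z - P z‖ ≤ ‖z - P z‖) ∧
      (∀ t z, ‖z - P z‖ ≤ η → G t z = z) ∧
      (∀ t z, G t z ≠ z → ‖P z - p‖ ≤ 2 ∧ ‖z - P z‖ ≤ r) ∧
      (∀ z, ‖P z - p‖ ≤ 1 → ‖z - P z‖ ≤ r / 2 → ‖G 1 z - P z‖ ≤ 2 * η) := by
  obtain ⟨c, hcc, hc0, hc1, hcη, hcr, hc2, hcm⟩ := exists_squeeze_profile hη hr
  -- Cutoff along the base: `1` within distance 1 of `p`, and `0` beyond distance 2.
  set a : E → ℝ := fun u => max 0 (min 1 (2 - ‖u - p‖)) with ha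
  have ha0 : ∀ u, 0 ≤ a u := fun u => le_max_left _ _
  have ha1 : ∀ u, a u ≤ 1 := fun u => max_le zero_le_one (min_le_left _ _)
  have hac : Continuous a := by fun_prop
  -- With weight `t * a u`, the radial map `s * C t u s` is a convex combination of `s` and `s * c
  -- s`, both strictly increasing on `s ≥ 0`.
  set C : unitInterval → E → ℝ → ℝ := fun t u s => 1 - (t * a u) * (1 - c s) with hC
  have hta : ∀ (t : unitInterval) u, 0 ≤ t * a u ∧ t * a u ≤ 1 := fun t u =>
    ⟨mul_nonneg t.2.1 (ha0 u), mul_le_one₀ t.2.2 (ha0 u) (ha1 u)⟩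
  have hCpos : ∀ t u s, 0 < C t u s := by
    intro t u s
    have := hta t u
    have h1 := hc0 s
    have h2 := hc1 s
    simp only [hC]
    nlinarith
  have hC1 : ∀ t u s, C t u s ≤ 1 := by
    intro t u s
    have := mul_nonneg (hta t u).1 (sub_nonneg.2 (hc1 s))
    simp only [hC]; linarith
  have hCmono : ∀ t u, StrictMonoOn (fun s => s * C t u s) (Ici 0) := by
    intro t u x hx y hy hxy
    have h1 := hcm hx hy hxy
    have := hta t u
    beta_reduce at h1
    simp only [hC]
    rcases eq_or_lt_of_le this.2 with h | h
    · rw [h]; linarith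
    · have h2 := mul_le_mul_of_nonneg_left h1.le this.1
      have h3 := mul_lt_mul_of_pos_left hxy (sub_pos.2 h)
      linarith
  set G : unitInterval → E → E := fun t z => P z + C t (P z) ‖z - P z‖ • (z - P z) with hG
  have hPz : ∀ z, z = P z + (1 : ℝ) • (z - P z) := fun z => by rw [one_smul, add_sub_cancel]
  have hGid : ∀ t z, C t (P z) ‖z - P z‖ = 1 → G t z = z := by
    intro t z h
    simp only [hG, h]
    exact (hPz z).symm
  have hGP : ∀ t z, ‖G t z - P z‖ = C t (P z) ‖z - P z‖ * ‖z - P z‖ := by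
    intro t z
    simp only [hG, add_sub_cancel_left]
    rw [norm_smul, Real.norm_of_nonneg (hCpos _ _ _).le]
  refine ⟨G, ?_, ?_, ?_, ?_, ?_, ?_, ?_, ?_, ?_⟩
  · simp only [hG, hC]; fun_prop
  · intro t
    refine bijective_fibrewise_stretch P hP (C t) (hCpos t) (fun u => ?_) (hCmono t) fun u =>
      ⟨r, fun s hs => ?_⟩
    · simp only [hC]; fun_prop
    · simp [hC, hcr s hs]
  · intro z
    exact hGid 0 z (by simp [hC])
  · intro t z
    simp [hG, hP]
  · intro t z
    have : G t z - z = (C t (P z) ‖z - P z‖ - 1) • (z - P z) := by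
      simp only [hG]; module
    rw [this, norm_smul]
    refine mul_le_of_le_one_left (norm_nonneg _) ?_
    rw [Real.norm_eq_abs, abs_le]
    have h1 := hCpos t (P z) ‖z - P z‖
    have h2 := hC1 t (P z) ‖z - P z‖
    constructor <;> linarith
  · intro t z
    rw [hGP]
    exact mul_le_of_le_one_left (norm_nonneg _) (hC1 _ _ _)
  · intro t z hz
    exact hGid t z (by simp [hC, hcη _ hz])
  · intro t z hz
    constructor
    · by_contra! h
      refine hz (hGid t z ?_)
      have : a (P z) = 0 := max_eq_left ((min_le_right _ _).trans (by linarith))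
      simp [hC, this]
    · by_contra! h
      exact hz (hGid t z (by simp [hC, hcr _ h.le]))
  · intro z h1 h2
    have : a (P z) = 1 := by
      simp only [ha]
      rw [min_eq_left (by linarith), max_eq_right zero_le_one]
    rw [hGP, mul_comm]
    simpa [hC, this] using hc2 _ (norm_nonneg _) h2

/-! ### Building ambient isotopies and extending them from a chart -/

/-- On a compact Hausdorff space, a homotopy through bijections starting at the identity is an
ambient isotopy. -/
theorem AmbientIsotopy.exists_of_bijective {Y : Type*} [TopologicalSpace Y] [CompactSpace Y]
    [T2Space Y] (H : unitInterval → Y → Y) (hH : Continuous fun q : unitInterval × Y => H q.1 q.2)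
    (hb : ∀ t, Function.Bijective (H t)) (h0 : ∀ y, H 0 y = y) :
    ∃ h : AmbientIsotopy Y, ∀ t y, h.homeo t y = H t y := by
  -- The level-preserving map is a continuous bijection from a compact space to a Hausdorff one, so
  -- its inverse is continuous; this yields joint continuity of the inverses.
  set Φ : unitInterval × Y ≃ unitInterval × Y := Equiv.ofBijective (fun q => (q.1, H q.1 q.2)) (by
    constructor
    · rintro ⟨s, x⟩ ⟨t, y⟩ h
      obtain ⟨rfl, h⟩ := Prod.mk.inj h
      exact Prod.ext rfl ((hb s).1 h)
    · rintro ⟨t, y⟩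
      obtain ⟨x, hx⟩ := (hb t).2 y
      exact ⟨(t, x), Prod.ext rfl hx⟩)
  have hΦc : Continuous Φ := continuous_fst.prodMk hH
  have hsymm : Continuous Φ.symm := hΦc.continuous_symm_of_equiv_compact_to_t2
  have hinv : ∀ t y, Φ.symm (t, y) = (t, (Equiv.ofBijective (H t) (hb t)).symm y) := by
    intro t y
    rw [Equiv.symm_apply_eq]
    exact Prod.ext rfl ((Equiv.ofBijective (H t) (hb t)).apply_symm_apply y).symm
  have hi : Continuous fun q : unitInterval × Y =>
      (Equiv.ofBijective (H q.1) (hb q.1)).symm q.2 := by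
    have := continuous_snd.comp hsymm
    convert this using 2 with q
    exact (congrArg Prod.snd (hinv q.1 q.2)).symm
  refine ⟨⟨fun t => ⟨Equiv.ofBijective (H t) (hb t), ?_, ?_⟩, hH, hi, ?_⟩, fun t y => rfl⟩
  · exact hH.comp (Continuous.prodMk_right t)
  · exact hi.comp (Continuous.prodMk_right t)
  · ext y; exact h0 y

/-- Extension by the identity of an isotopy of a chart domain with compact support. -/
theorem AmbientIsotopy.exists_extend {Y E : Type*} [TopologicalSpace Y] [CompactSpace Y]
    [T2Space Y] [TopologicalSpace E] (φ : OpenPartialHomeomorph Y E) (hφ : φ.target = univ)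
    (G : unitInterval → E → E) (hG : Continuous fun q : unitInterval × E => G q.1 q.2)
    (hb : ∀ t, Function.Bijective (G t)) (h0 : ∀ z, G 0 z = z) {K : Set E} (hK : IsCompact K)
    (hGK : ∀ t z, G t z ≠ z → z ∈ K) :
    ∃ h : AmbientIsotopy Y, h.support ⊆ φ.symm '' K ∧
      (∀ t z, h.homeo t (φ.symm z) = φ.symm (G t z)) ∧
      ∀ t, ∀ y ∉ φ.source, h.homeo t y = y := by
  classical
  have hsc : Continuous φ.symm := by
    have := φ.continuousOn_symm
    rwa [hφ, continuousOn_univ] at this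
  have hsrc : ∀ z, φ.symm z ∈ φ.source := fun z => φ.map_target (hφ ▸ mem_univ z)
  have hright : ∀ z, φ (φ.symm z) = z := fun z => φ.right_inv (hφ ▸ mem_univ z)
  have hcl : IsClosed (φ.symm '' K) := (hK.image hsc).isClosed
  set H : unitInterval → Y → Y := fun t y => if y ∈ φ.source then φ.symm (G t (φ y)) else y with hH
  have hH1 : ∀ t, ∀ y ∈ φ.source, H t y = φ.symm (G t (φ y)) := fun t y hy => if_pos hy
  have hH2 : ∀ t, ∀ y ∉ φ.source, H t y = y := fun t y hy => if_neg hy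
  have hH3 : ∀ t, ∀ y ∉ φ.symm '' K, H t y = y := by
    intro t y hy
    by_cases hs : y ∈ φ.source
    · rw [hH1 t y hs]
      have : G t (φ y) = φ y := by
        by_contra hne
        exact hy ⟨φ y, hGK t _ hne, φ.left_inv hs⟩
      rw [this, φ.left_inv hs]
    · exact hH2 t y hs
  have hcont : Continuous fun q : unitInterval × Y => H q.1 q.2 := by
    rw [continuous_iff_continuousAt]
    rintro ⟨t, y⟩
    by_cases hy : y ∈ φ.source
    · have h1 : ContinuousAt (fun q : unitInterval × Y => φ.symm (G q.1 (φ q.2))) (t, y) := by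
        have h2 : ContinuousAt (fun q : unitInterval × Y => (q.1, φ q.2)) (t, y) :=
          continuousAt_fst.prodMk
            (ContinuousAt.comp (f := Prod.snd) (x := (t, y)) (φ.continuousAt hy) continuousAt_snd)
        exact (hsc.comp hG).continuousAt.comp h2
      refine h1.congr ?_
      filter_upwards [continuousAt_snd.preimage_mem_nhds (φ.open_source.mem_nhds hy)] with q hq
      exact (hH1 q.1 q.2 hq).symm
    -- The image of `K` is compact, hence closed in `Y`, so `H` is the identity near a point outside
    -- the chart.
    · have hyK : y ∈ (φ.symm '' K)ᶜ := by
        rintro ⟨z, _, rfl⟩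
        exact hy (hsrc z)
      refine continuousAt_snd.congr ?_
      filter_upwards [continuousAt_snd.preimage_mem_nhds (hcl.isOpen_compl.mem_nhds hyK)] with q hq
      exact (hH3 q.1 q.2 hq).symm
  have hbij : ∀ t, Function.Bijective (H t) := by
    intro t
    constructor
    · intro x y hxy
      by_cases hx : x ∈ φ.source <;> by_cases hy : y ∈ φ.source
      · rw [hH1 t x hx, hH1 t y hy] at hxy
        have := congrArg φ hxy
        rw [hright, hright] at this
        exact φ.injOn hx hy ((hb t).1 this)
      · rw [hH1 t x hx, hH2 t y hy] at hxy
        exact absurd (hxy ▸ hsrc _) hy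
      · rw [hH2 t x hx, hH1 t y hy] at hxy
        exact absurd (hxy ▸ hsrc _) hx
      · rwa [hH2 t x hx, hH2 t y hy] at hxy
    · intro y
      by_cases hy : y ∈ φ.source
      · obtain ⟨z, hz⟩ := (hb t).2 (φ y)
        refine ⟨φ.symm z, ?_⟩
        rw [hH1 t _ (hsrc z), hright, hz, φ.left_inv hy]
      · exact ⟨y, hH2 t y hy⟩
  have hzero : ∀ y, H 0 y = y := by
    intro y
    by_cases hy : y ∈ φ.source
    · rw [hH1 0 y hy, h0, φ.left_inv hy]
    · exact hH2 0 y hy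
  obtain ⟨h, hh⟩ := AmbientIsotopy.exists_of_bijective H hcont hbij hzero
  refine ⟨h, ?_, ?_, ?_⟩
  · refine closure_minimal ?_ hcl
    rintro y ⟨t, ht⟩
    by_contra hy
    exact ht ((hh t y).trans (hH3 t y hy))
  · intro t z
    rw [hh, hH1 t _ (hsrc z), hright]
  · intro t y hy
    rw [hh, hH2 t y hy]

/-! ### The flat model and thin tubes around it -/

/-- The subspace `ℝᵈ × 0` of `ℝⁿ` as a submodule. -/
def flatSubmodule (n d : ℕ) : Submodule ℝ (EuclideanSpace ℝ (Fin n)) where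
  carrier := flatSubspace n d
  zero_mem' := fun _ _ => rfl
  add_mem' := fun {x y} hx hy i hi => by simp [hx i hi, hy i hi]
  smul_mem' := fun a x hx i hi => by simp [hx i hi]

/-- A bounded part of a sufficiently thin tube around a subspace lies in a given neighbourhood
of the subspace. -/
theorem Submodule.exists_tube_subset {E : Type*} [NormedAddCommGroup E] [InnerProductSpace ℝ E]
    [FiniteDimensional ℝ E] (K : Submodule ℝ E) (p : E) (R : ℝ) {O : Set E}
    (hO : IsOpen O) (hKO : (K : Set E) ⊆ O) :
    ∃ δ > 0, ∀ z, ‖K.starProjection z - p‖ ≤ R → ‖z - K.starProjection z‖ < δ → z ∈ O := by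
  have hcomp : IsCompact (Metric.closedBall p R ∩ K) :=
    (isCompact_closedBall p R).inter_right K.closed_of_finiteDimensional
  obtain ⟨δ, hδ, h⟩ := hcomp.exists_thickening_subset_open hO (inter_subset_right.trans hKO)
  refine ⟨δ, hδ, fun z hz hzδ => h (Metric.mem_thickening_iff.2 ⟨K.starProjection z, ⟨?_, ?_⟩, ?_⟩)⟩
  · rwa [mem_closedBall_iff_norm]
  · exact K.starProjection_apply_mem z
  · rwa [dist_eq_norm]

/-! ### Composition and supports of isotopies -/

/-- The composition of two ambient isotopies. -/
def AmbientIsotopy.comp {Y : Type*} [TopologicalSpace Y] (g f : AmbientIsotopy Y) :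
    AmbientIsotopy Y where
  homeo t := (f.homeo t).trans (g.homeo t)
  continuous_homeo := g.continuous_homeo.comp (continuous_fst.prodMk f.continuous_homeo)
  continuous_symm := f.continuous_symm.comp (continuous_fst.prodMk g.continuous_symm)
  homeo_zero := by rw [f.homeo_zero, g.homeo_zero]; rfl

theorem AmbientIsotopy.support_comp_subset {Y : Type*} [TopologicalSpace Y]
    (g f : AmbientIsotopy Y) : (g.comp f).support ⊆ g.support ∪ f.support := by
  rw [support, support, support, ← closure_union]
  refine closure_mono ?_
  rintro y ⟨t, ht⟩
  by_contra h
  simp only [mem_union, mem_ofPred_eq, not_or, not_exists, not_not] at h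
  exact ht ((congrArg (g.homeo t) (h.2 t)).trans (h.1 t))

/-- The constant isotopy. -/
def AmbientIsotopy.refl (Y : Type*) [TopologicalSpace Y] : AmbientIsotopy Y where
  homeo _ := Homeomorph.refl Y
  continuous_homeo := continuous_snd
  continuous_symm := continuous_snd
  homeo_zero := rfl

theorem AmbientIsotopy.support_refl (Y : Type*) [TopologicalSpace Y] :
    (AmbientIsotopy.refl Y).support = ∅ := by
  have : {y | ∃ t, (AmbientIsotopy.refl Y).homeo t y ≠ y} = ∅ :=
    eq_empty_of_forall_notMem fun y ⟨_, ht⟩ => ht rfl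
  rw [support, this, closure_empty]

/-! ### Fine compressibility: gluing and the local case -/

/-- A uniform neighbourhood of the subset `A` of `X` can be compressed into any neighbourhood
of `X`, by isotopies supported in `F` which move points by less than any prescribed `ε`. -/
def FinelyCompressible {Y : Type*} [MetricSpace Y] (X F A : Set Y) : Prop :=
  ∀ ε > 0, ∃ δ > 0, ∀ D ∈ 𝓝ˢ X, ∃ h : AmbientIsotopy Y,
    (∃ N ∈ 𝓝ˢ X, ∀ t : unitInterval, ∀ y ∈ N, h.homeo t y = y) ∧
    h.support ⊆ F ∧ (∀ y, dist (h.homeo 1 y) y < ε) ∧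
    ∀ y ∈ Metric.thickening δ A, h.homeo 1 y ∈ D

namespace FinelyCompressible

variable {Y : Type*} [MetricSpace Y] {X F A B : Set Y}

theorem empty : FinelyCompressible X F ∅ := by
  refine fun ε hε => ⟨1, one_pos, fun D _ => ⟨.refl Y, ⟨univ, Filter.univ_mem, fun _ _ _ => rfl⟩,
    ?_, fun y => ?_, fun y hy => ?_⟩⟩
  · rw [AmbientIsotopy.support_refl]
    exact empty_subset _
  · exact (dist_self y).trans_lt hε
  · simp at hy

theorem mono (hAB : A ⊆ B) (h : FinelyCompressible X F B) : FinelyCompressible X F A := by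
  intro ε hε
  obtain ⟨δ, hδ, H⟩ := h ε hε
  refine ⟨δ, hδ, fun D hD => ?_⟩
  obtain ⟨f, hN, hF, hd, hf⟩ := H D hD
  exact ⟨f, hN, hF, hd, fun y hy => hf y (Metric.thickening_subset_of_subset δ hAB hy)⟩

/-- Compress near `A` by `f`, then near `B` by `g`. If `f` moves points by less than `δB / 2`, the
`δB / 2`-neighbourhood of `B` remains where `g` controls it. Given `D`, choose `g` first and aim `f`
at the preimage of `D` under `g`; this is legitimate because `δB` is independent of `D`. -/
theorem union (hA : FinelyCompressible X F A) (hB : FinelyCompressible X F B) :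
    FinelyCompressible X F (A ∪ B) := by
  intro ε hε
  obtain ⟨δB, hδB, HB⟩ := hB (ε / 2) (half_pos hε)
  obtain ⟨δA, hδA, HA⟩ := hA (min (ε / 2) (δB / 2)) (lt_min (half_pos hε) (half_pos hδB))
  refine ⟨min δA (δB / 2), lt_min hδA (half_pos hδB), fun D hD => ?_⟩
  obtain ⟨g, ⟨M, hM, hgM⟩, hgF, hgd, hg⟩ := HB D hD
  -- The preimage is again a neighbourhood of `X` because `g` fixes `X`.
  have hD' : g.homeo 1 ⁻¹' D ∈ 𝓝ˢ X := by
    refine mem_nhdsSet_iff_forall.2 fun x hx => ?_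
    refine (g.homeo 1).continuous.continuousAt.preimage_mem_nhds ?_
    rw [hgM 1 x (subset_of_mem_nhdsSet hM hx)]
    exact mem_nhdsSet_iff_forall.1 hD x hx
  obtain ⟨f, ⟨N, hN, hfN⟩, hfF, hfd, hf⟩ := HA _ hD'
  refine ⟨g.comp f, ⟨M ∩ N, Filter.inter_mem hM hN, fun t y hy => ?_⟩,
    (g.support_comp_subset f).trans (union_subset hgF hfF), fun y => ?_, fun y hy => ?_⟩
  · exact (congrArg (g.homeo t) (hfN t y hy.2)).trans (hgM t y hy.1)
  · have h1 := hgd (f.homeo 1 y)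
    have h2 := (hfd y).trans_le (min_le_left _ _)
    exact (dist_triangle _ _ _).trans_lt ((add_lt_add h1 h2).trans_eq (add_halves ε))
  · rw [Metric.thickening_union] at hy
    rcases hy with hy | hy
    · exact hf y (Metric.thickening_mono (min_le_left _ _) A hy)
    · refine hg _ ?_
      obtain ⟨b, hb, hyb⟩ := Metric.mem_thickening_iff.1 hy
      refine Metric.mem_thickening_iff.2 ⟨b, hb, ?_⟩
      have h1 := (hfd y).trans_le (min_le_right _ _)
      have h2 := hyb.trans_le (min_le_right _ _)
      exact (dist_triangle _ y _).trans_lt ((add_lt_add h1 h2).trans_eq (add_halves δB))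

/-- A locally flat set is finely compressible near each of its points. -/
theorem exists_mem_nhdsWithin [CompactSpace Y] {n d : ℕ} (hX : IsLocallyFlat n d X)
    (hF : F ∈ 𝓝ˢ X) {x : Y} (hx : x ∈ X) : ∃ A ∈ 𝓝[X] x, FinelyCompressible X F A := by
  obtain ⟨φ, hxφ, hφ, hφX⟩ := hX x hx
  set K := flatSubmodule n d
  set P := K.starProjection
  have hPP : ∀ z, P (P z) = P z := fun z => K.starProjection_eq_self_iff.2
    (K.starProjection_apply_mem z)
  have hPK : ∀ z ∈ K, P z = z := fun z hz => K.starProjection_eq_self_iff.2 hz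
  have hsc : Continuous φ.symm := by
    have := φ.continuousOn_symm
    rwa [hφ, continuousOn_univ] at this
  have hsrc : ∀ z, φ.symm z ∈ φ.source := fun z => φ.map_target (hφ ▸ mem_univ z)
  have hright : ∀ z, φ (φ.symm z) = z := fun z => φ.right_inv (hφ ▸ mem_univ z)
  have hXK : ∀ y ∈ φ.source, y ∈ X → φ y ∈ K := fun y hy hyX =>
    (hφX ▸ mem_image_of_mem φ ⟨hy, hyX⟩ : φ y ∈ flatSubspace n d)
  have hKX : ∀ z ∈ K, φ.symm z ∈ X := by
    intro z hz
    obtain ⟨y, ⟨hy, hyX⟩, rfl⟩ : z ∈ φ '' (φ.source ∩ X) := hφX ▸ hz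
    rwa [φ.left_inv hy]
  set p := φ x
  have hdist : Continuous fun z => ‖P z - p‖ := by fun_prop
  have hheight : Continuous fun z => ‖z - P z‖ := by fun_prop
  have htube : ∀ D ∈ 𝓝ˢ X, ∃ δ > 0, ∀ z, ‖P z - p‖ ≤ 2 → ‖z - P z‖ < δ → φ.symm z ∈ D := by
    intro D hD
    obtain ⟨O, hO, hXO, hOD⟩ := mem_nhdsSet_iff_exists.1 hD
    obtain ⟨δ, hδ, h⟩ := K.exists_tube_subset p 2 (hO.preimage hsc) fun z hz => hXO (hKX z hz)
    exact ⟨δ, hδ, fun z h1 h2 => hOD (h z h1 h2)⟩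
  -- Radius `1 / 2` leaves room for a thickening inside the region `‖P z - p‖ < 1`, where the
  -- squeeze acts at full strength.
  refine ⟨φ.symm '' (Metric.closedBall p (1 / 2) ∩ K), ?_, ?_⟩
  · have h1 : φ ⁻¹' Metric.closedBall p (1 / 2) ∈ 𝓝 x :=
      (φ.continuousAt hxφ).preimage_mem_nhds (Metric.closedBall_mem_nhds p (by norm_num))
    filter_upwards [nhdsWithin_le_nhds h1, nhdsWithin_le_nhds (φ.open_source.mem_nhds hxφ),
      self_mem_nhdsWithin] with y hy1 hy2 hy3
    exact ⟨φ y, ⟨hy1, hXK y hy2 hy3⟩, φ.left_inv hy2⟩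
  intro ε hε
  obtain ⟨ρ, hρ, hρF⟩ := htube F hF
  have huc : UniformContinuousOn φ.symm (Metric.closedBall p 3) :=
    (isCompact_closedBall p 3).uniformContinuousOn_of_continuous hsc.continuousOn
  obtain ⟨ω, hω, hωε⟩ := Metric.uniformContinuousOn_iff.1 huc ε hε
  -- The tube height `r` is fixed before `D`: `ρ` keeps the support in `F`, `ω` keeps displacements
  -- below `ε`, and `1` keeps the tube in the ball of radius `3`.
  obtain ⟨r, hr0, hr⟩ : ∃ r > 0, r < min ρ (min ω 1) :=
    exists_between (lt_min hρ (lt_min hω one_pos))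
  obtain ⟨hrρ, hr⟩ := lt_min_iff.1 hr
  obtain ⟨hrω, hr1⟩ := lt_min_iff.1 hr
  have hball : ∀ z, ‖P z - p‖ ≤ 2 → ‖z - P z‖ ≤ r → z ∈ Metric.closedBall p 3 := by
    intro z h1 h2
    rw [mem_closedBall_iff_norm]
    have := norm_add_le (z - P z) (P z - p)
    rw [sub_add_sub_cancel] at this
    linarith
  have hAcomp : IsCompact (φ.symm '' (Metric.closedBall p (1 / 2) ∩ K)) :=
    ((isCompact_closedBall p _).inter_right K.closed_of_finiteDimensional).image hsc
  have hU : IsOpen (φ.source ∩ φ ⁻¹' ({z | ‖P z - p‖ < 1} ∩ {z | ‖z - P z‖ < r / 2})) := by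
    refine φ.isOpen_inter_preimage ?_
    exact (isOpen_lt hdist continuous_const).inter (isOpen_lt hheight continuous_const)
  obtain ⟨δ, hδ, hδU⟩ := hAcomp.exists_thickening_subset_open hU (by
    rintro _ ⟨z, ⟨hz, hzK⟩, rfl⟩
    refine ⟨hsrc z, ?_⟩
    rw [mem_closedBall_iff_norm] at hz
    simp only [mem_preimage, mem_inter_iff, mem_ofPred_eq, hright, hPK z hzK, sub_self, norm_zero]
    constructor <;> linarith)
  refine ⟨δ, hδ, fun D hD => ?_⟩
  obtain ⟨σ, hσ, hσD⟩ := htube D hD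
  -- Only `η` depends on `D`: `2 * η < σ` makes the squeezed tube land in `D`, and `2 * η < r` is
  -- what the squeeze requires.
  obtain ⟨η, hη, hη'⟩ : ∃ η > 0, η < min (σ / 2) (r / 2) :=
    exists_between (lt_min (half_pos hσ) (half_pos hr0))
  obtain ⟨hησ, hηr⟩ := lt_min_iff.1 hη'
  obtain ⟨G, hGc, hGb, hG0, hGP, hGd, hGn, hGη, hGs, hGsq⟩ :=
    exists_tube_squeeze P hPP p hη (r := r) (by linarith)
  set S := {z | ‖P z - p‖ ≤ 2} ∩ {z | ‖z - P z‖ ≤ r}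
  have hScl : IsClosed S := (isClosed_le hdist continuous_const).inter
    (isClosed_le hheight continuous_const)
  have hScomp : IsCompact S := (isCompact_closedBall p 3).of_isClosed_subset hScl
    fun z hz => hball z hz.1 hz.2
  obtain ⟨h, hsupp, hin, hout⟩ :=
    AmbientIsotopy.exists_extend φ hφ G hGc hGb hG0 hScomp hGs
  have hin' : ∀ t, ∀ y ∈ φ.source, h.homeo t y = φ.symm (G t (φ y)) := by
    intro t y hy
    rw [← hin, φ.left_inv hy]
  refine ⟨h, ⟨{y | ∀ t, h.homeo t y = y}, ?_, fun t y hy => hy t⟩, ?_, ?_, ?_⟩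
  · refine mem_nhdsSet_iff_forall.2 fun w hw => ?_
    -- Inside the chart, points of `X` have height `0`, so the tube of height `η` fixed by `G`
    -- surrounds them; points outside the chart avoid the closed set `φ.symm '' S` containing the
    -- support.
    by_cases hwφ : w ∈ φ.source
    · have h1 : {z | ‖z - P z‖ < η} ∈ 𝓝 (φ w) := by
        refine (isOpen_lt hheight continuous_const).mem_nhds ?_
        simpa [hPK _ (hXK w hwφ hw)] using hη
      filter_upwards [(φ.continuousAt hwφ).preimage_mem_nhds h1,
        φ.open_source.mem_nhds hwφ] with y hy hyφ t
      rw [hin' t y hyφ, hGη t _ (le_of_lt hy), φ.left_inv hyφ]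
    · have h1 : (φ.symm '' S)ᶜ ∈ 𝓝 w := by
        refine (hScomp.image hsc).isClosed.isOpen_compl.mem_nhds ?_
        rintro ⟨z, _, rfl⟩
        exact hwφ (hsrc z)
      filter_upwards [h1] with y hy t
      by_contra hne
      exact hy (hsupp (subset_closure ⟨t, hne⟩))
  · refine hsupp.trans ?_
    rintro _ ⟨z, hz, rfl⟩
    exact hρF z hz.1 (hz.2.trans_lt hrρ)
  · intro y
    by_cases hy : y ∈ φ.source
    · by_cases hne : G 1 (φ y) = φ y
      · rw [hin' 1 y hy, hne, φ.left_inv hy, dist_self]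
        exact hε
      · obtain ⟨h1, h2⟩ := hGs 1 _ hne
        have h3 := hωε (G 1 (φ y)) (hball _ (by rwa [hGP])
          (by rw [hGP]; exact (hGn 1 _).trans h2)) (φ y) (hball _ h1 h2)
          (by rw [dist_eq_norm]; exact ((hGd 1 _).trans h2).trans_lt hrω)
        rwa [← hin' 1 y hy, φ.left_inv hy] at h3
    · rw [hout 1 y hy, dist_self]
      exact hε
  · intro y hy
    obtain ⟨hyφ, (h1 : ‖P (φ y) - p‖ < 1), (h2 : ‖φ y - P (φ y)‖ < r / 2)⟩ := hδU hy
    rw [hin' 1 y hyφ]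
    refine hσD _ ?_ ?_
    · rw [hGP]; exact (le_of_lt h1).trans one_le_two
    · rw [hGP]
      exact (hGsq _ h1.le h2.le).trans_lt (by linarith)

/-- A compact locally flat set is finely compressible. -/
theorem of_isLocallyFlat [CompactSpace Y] {n d : ℕ} (hXc : IsCompact X)
    (hX : IsLocallyFlat n d X) (hF : F ∈ 𝓝ˢ X) : FinelyCompressible X F X :=
  hXc.induction_on (p := FinelyCompressible X F) empty (fun _ _ hst h => h.mono hst) (fun _ _ hs ht => hs.union ht)
    fun _ hx => exists_mem_nhdsWithin hX hF hx

end FinelyCompressible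

/-! ### The compression theorem -/

/-- The axiom `I-Comp(Y, X)` holds for a compact locally flat submanifold `X` of a compact
topological manifold `Y`; moreover the pair of neighbourhoods exists inside any prescribed
neighbourhood of `X`. -/
theorem mainTheorem5 {Y : Type*} [TopologicalSpace Y] [CompactSpace Y] (n d : ℕ) (hdn : d ≤ n)
    (hY : IsTopologicalManifold n Y) (X : Set Y) (hXc : IsCompact X)
    (hX : IsLocallyFlat n d X) :
    IComp Y X ∧ ∀ F ∈ 𝓝ˢ X, ∃ E ∈ 𝓝ˢ X, E ⊆ F ∧ ICompressible X E F := by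
  have hT2 := hY.t2
  have hSC := hY.secondCountable
  -- A compact Hausdorff second countable space is metrizable; any compatible metric will do.
  let : MetricSpace Y := TopologicalSpace.metrizableSpaceMetric Y
  have key : ∀ F ∈ 𝓝ˢ X, ∃ E ∈ 𝓝ˢ X, E ⊆ F ∧ ICompressible X E F := by
    intro F hF
    -- The displacement bound served only the gluing, so `ε = 1` is an arbitrary choice here.
    obtain ⟨δ, hδ, H⟩ := FinelyCompressible.of_isLocallyFlat hXc hX hF 1 one_pos
    have hE : Metric.thickening δ X ∈ 𝓝ˢ X :=
      Metric.isOpen_thickening.mem_nhdsSet.2 (Metric.self_subset_thickening hδ X)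
    refine ⟨Metric.thickening δ X ∩ F, Filter.inter_mem hE hF, inter_subset_right, fun D hD => ?_⟩
    obtain ⟨h, hN, hsupp, -, hD'⟩ := H D hD
    exact ⟨h, hN, hsupp, image_subset_iff.2 fun y hy => hD' y hy.1⟩
  refine ⟨?_, key⟩
  obtain ⟨E, hE, hEF, hc⟩ := key univ Filter.univ_mem
  exact ⟨E, hE, univ, Filter.univ_mem, hEF, hc⟩
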